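/- Let $G$ be a finite simple connected graph with $n$ vertices, $m$ edges and minimum degree $\delta(G)\ge 3$. Let $A$ be its adjacency matrix, $D$ its diagonal degree matrix and $I$ the $n\times n$ identity matrix. For complex $u$ near $1/2$ put $$h_G(u)=\det\bigl(I-\sqrt{u(1-u)}\,A+u(D-2I)\bigr),\qquad l_G(u)=\det\bigl(I+\sqrt{u(1-u)}\,A+u(D-2I)\bigr),$$ where for each $u$ the same value of $\sqrt{u(1-u)}$ is used in both determinants (any choice of the values is allowed), and let $p_G(u)=h_G(u)\,l_G(u)$. Let $\kappa(G)$ be the number of spanning trees of $G$. Let $OUCF(G)$ be the set of odd-unicyclic factors of $G$, that is, of spanning subgraphs $H$ of $G$ (with $V(H)=V(G)$) such that each connected component of $H$ contains exactly one cycle and this cycle has odd length; let $\omega(H)$ be the number of connected components of $H$, and put $$\iota(G)=\sum_{H\in OUCF(G)}4^{\omega(H)}.$$ Then $p_G$ is analytic at $u=1/2$ and $p_G(1/2)=0$. If $G$ is not bipartite, then $$p_G'(1/2)=\frac{m-n}{2^{2n-2}}\,\kappa(G)\,\iota(G).$$ If $G$ is bipartite, then $p_G'(1/2)=0$ and $$p_G''(1/2)=\frac{(m-n)^2}{2^{2n-5}}\,\kappa(G)^2.$$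 -/

import Mathlib

namespace QWZeta

noncomputable section

open SimpleGraph

variable {V : Type*}

/-- A subgraph `C` is an unoriented cycle: it is the subgraph of vertices and edges traversed by
some closed walk with at least three edges and no repeated vertex (other than its endpoints) or
repeated edge. The starting point and the direction of the walk are forgotten. -/
def IsUnorientedCycle {H : SimpleGraph V} (C : H.Subgraph) : Prop :=
  ∃ (v : V) (w : H.Walk v v), w.IsCycle ∧ w.toSubgraph = C

/-- `H` is odd-unicyclic componentwise: each connected component of `H` contains exactly one
unoriented cycle, and that cycle has odd length (its number of vertices). -/
def IsOddUnicyclic (H : SimpleGraph V) : Prop :=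
  ∀ c : H.ConnectedComponent, ∃ C : H.Subgraph,
    (IsUnorientedCycle C ∧ C.verts ⊆ c.supp) ∧ Odd C.verts.ncard ∧
      ∀ C' : H.Subgraph, IsUnorientedCycle C' → C'.verts ⊆ c.supp → C' = C

/-- The set of odd-unicyclic factors of `G`. Spanning subgraphs of `G` are the simple graphs
`H ≤ G` on the same vertex type. -/
def oucf (G : SimpleGraph V) : Set (SimpleGraph V) :=
  {H | H ≤ G ∧ IsOddUnicyclic H}

/-- The number of connected components. -/
def numComponents (H : SimpleGraph V) : ℕ :=
  Nat.card H.ConnectedComponent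

/-- The sum of `4 ^ ω(H)` over the odd-unicyclic factors `H` of `G`. -/
def iota [Finite V] (G : SimpleGraph V) : ℕ :=
  ∑ H ∈ (Set.toFinite (oucf G)).toFinset, 4 ^ numComponents H

/-- The complexity of `G`: the number of its spanning trees. -/
def complexity (G : SimpleGraph V) : ℕ :=
  Set.ncard {T : SimpleGraph V | T ≤ G ∧ T.IsTree}

section zeta

variable [Fintype V] [DecidableEq V] (G : SimpleGraph V) [DecidableRel G.Adj]

/-- `h_G(u) = det (I - √(u(1-u)) A + u (D - 2 I))`, where `r` is the chosen branch of
`u ↦ √(u(1-u))`. -/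
def hG (r : ℂ → ℂ) (u : ℂ) : ℂ :=
  (1 - r u • G.adjMatrix ℂ + u • (G.degMatrix ℂ - (2 : ℂ) • (1 : Matrix V V ℂ))).det

/-- `l_G(u) = det (I + √(u(1-u)) A + u (D - 2 I))`, where `r` is the chosen branch of
`u ↦ √(u(1-u))`. -/
def lG (r : ℂ → ℂ) (u : ℂ) : ℂ :=
  (1 + r u • G.adjMatrix ℂ + u • (G.degMatrix ℂ - (2 : ℂ) • (1 : Matrix V V ℂ))).det

/-- `p_G = h_G l_G`, with the same branch of the square root in both factors. -/
def pG (r : ℂ → ℂ) (u : ℂ) : ℂ :=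
  hG G r u * lG G r u

end zeta

end

end QWZeta

/-!
Near `1/2` the function `p_G` does not depend on the choice of the square root, because a change of
sign exchanges its two factors; so a branch `s` analytic at `1/2` with `s (1/2) = 1/2` may be used,
and then `s' (1/2) = 0`. At `u = 1/2` the two matrices are `(D - A) / 2` and `(D + A) / 2`, half the
Laplacian `L` and half the signless Laplacian `Q`. Hence `h_G (1/2) = 0`, and by Jacobi's formula
`h_G' (1/2)` is the trace of `adj (L / 2) (D - 2 I)`. The diagonal cofactors of `L` are all equal to
`κ(G)`, by the matrix-tree theorem `det_signedLap_add_single`, so `h_G' (1/2)` equals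
`2 (m - n) κ(G) / 2 ^ (n - 1)`. Therefore `p_G' (1/2) = h_G' (1/2) l_G (1/2)` with
`l_G (1/2) = det Q / 2 ^ n`, and it remains to see that `det Q = ι(G)` (`det_signedLap_one`). If `G`
is bipartite, then `h_G = l_G`, so `p_G = h_G ^ 2` and `p_G'' (1/2) = 2 h_G' (1/2) ^ 2`.

Both determinants are computed by writing `D ± A` as the sum of the squares of the edge vectors and
applying Cauchy–Binet (`det_sum_vecMulVec`), which reduces them to spanning subgraphs with few
edges. The evaluation on those rests on one identity for a tree `T`, namely
`det (L_T + y yᵀ) = (∑ v, y v) ^ 2` (`det_signedLap_add_vecMulVec_of_isTree`): the incidence matrix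
of a tree bordered by a unit vector is unimodular. With `y = e_r` it gives the matrix-tree theorem.
For `Q`, a subgraph with `n` edges splits into its components. If one of them is a tree, the
determinant vanishes; otherwise each is a tree plus one edge, and after the change of signs that
turns `Q_T` into `L_T` the identity gives `4` or `0` according as the unique cycle is odd or even.
-/

namespace QWZeta

open SimpleGraph Matrix Finset

/-! ### The Cauchy–Binet formula -/

section CauchyBinet

variable {ι V R : Type*} [Fintype V] [DecidableEq V] [CommRing R]

/-- Multilinear expansion along the rows: the row `v` of `∑ i ∈ T, x i (x i)ᵀ` is the combination
`∑ i ∈ T, x i v • x i`. A choice function `f` that repeats an index contributes a determinant with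
two equal rows, so only the injective ones survive. -/
theorem det_sum_vecMulVec_eq_sum_piFinset [DecidableEq ι] (T : Finset ι) (x : ι → V → R) :
    (∑ i ∈ T, vecMulVec (x i) (x i)).det =
      ∑ f ∈ (Fintype.piFinset fun _ : V => T) with Function.Injective f,
        (∏ v, x (f v) v) * (Matrix.of fun v => x (f v)).det := by
  have h : (∑ i ∈ T, vecMulVec (x i) (x i)) = fun v => ∑ i ∈ T, x i v • x i := by
    ext v w
    simp [Matrix.sum_apply, vecMulVec_apply, Finset.sum_apply]
  rw [h, Finset.sum_filter]
  change (detRowAlternating (R := R) (n := V)).toMultilinearMap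
    (fun v => ∑ i ∈ T, x i v • x i) = _
  rw [MultilinearMap.map_sum_finset]
  refine Finset.sum_congr rfl fun f _ => ?_
  rw [MultilinearMap.map_smul_univ]
  split_ifs with hf
  · rfl
  · obtain ⟨v, w, hvw, hne⟩ := Function.not_injective_iff.1 hf
    have : detRowAlternating (R := R) (fun v => x (f v)) = 0 :=
      AlternatingMap.map_eq_zero_of_eq _ _ (by rw [hvw]) hne
    change _ • detRowAlternating (R := R) (fun v => x (f v)) = 0
    rw [this, smul_zero]

/-- The Cauchy–Binet formula for `M Mᵀ`, written for a sum of rank-one matrices: each minor squared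
appears as the determinant of the sum over a subset of `|V|` of the vectors. -/
theorem det_sum_vecMulVec [DecidableEq ι] (T : Finset ι) (x : ι → V → R) :
    (∑ i ∈ T, vecMulVec (x i) (x i)).det =
      ∑ S ∈ T.powersetCard (Fintype.card V), (∑ i ∈ S, vecMulVec (x i) (x i)).det := by
  simp_rw [det_sum_vecMulVec_eq_sum_piFinset]
  rw [← Finset.sum_fiberwise_of_maps_to (g := fun f => univ.image f)
    (t := T.powersetCard (Fintype.card V))]
  · refine Finset.sum_congr rfl fun S hS => Finset.sum_congr ?_ fun _ _ => rfl
    rw [mem_powersetCard] at hS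
    ext f
    simp only [mem_filter, Fintype.mem_piFinset]
    constructor
    · rintro ⟨⟨-, hinj⟩, rfl⟩
      exact ⟨fun v => mem_image_of_mem _ (mem_univ v), hinj⟩
    · rintro ⟨hf, hinj⟩
      refine ⟨⟨fun v => hS.1 (hf v), hinj⟩, Finset.eq_of_subset_of_card_le ?_ ?_⟩
      · intro s hs
        obtain ⟨v, -, rfl⟩ := mem_image.1 hs
        exact hf v
      · rw [card_image_of_injective _ hinj, hS.2, card_univ]
  · intro f hf
    simp only [mem_filter, Fintype.mem_piFinset] at hf
    rw [mem_powersetCard, card_image_of_injective _ hf.2, card_univ]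
    refine ⟨fun s hs => ?_, rfl⟩
    obtain ⟨v, -, rfl⟩ := mem_image.1 hs
    exact hf.1 v

end CauchyBinet

/-! ### Signed Laplacians and their expansion over spanning subgraphs -/

section SignedLaplacian

variable {V : Type*} [DecidableEq V]

/-- The incidence vector of an edge: `1` at one end and `ε` at the other. The end that carries `1`
is the first entry of the representative `Quot.out`; for `ε = ±1` the matrix
`edgeVec ε e (edgeVec ε e)ᵀ` does not depend on that choice. -/
noncomputable def edgeVec (ε : ℤ) (e : Sym2 V) : V → ℤ :=
  Pi.single e.out.1 1 + ε • Pi.single e.out.2 1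

theorem edgeVec_mul_edgeVec {ε : ℤ} (hε : ε * ε = 1) {e : Sym2 V} (he : ¬ e.IsDiag) (i j : V) :
    edgeVec ε e i * edgeVec ε e j =
      if i = j then (if i ∈ e then 1 else 0) else (if e = s(i, j) then ε else 0) := by
  have hout : s(e.out.1, e.out.2) = e := Quot.out_eq e
  unfold edgeVec
  generalize e.out.1 = a at hout
  generalize e.out.2 = b at hout
  subst hout
  have hab : a ≠ b := by simpa using he
  have hab' := hab.symm
  simp only [Pi.add_apply, Pi.smul_apply, Pi.single_apply, smul_eq_mul, Sym2.mem_iff,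
    Sym2.eq_iff]
  by_cases h1 : i = a <;> by_cases h2 : i = b <;> by_cases h3 : j = a <;> by_cases h4 : j = b <;>
    by_cases h5 : i = j <;> grind

variable [Fintype V]

open Classical in
/-- The matrix `D + ε A` over `ℤ`: the Laplacian for `ε = -1`, the signless Laplacian for `ε = 1`.
It uses classical decidability of adjacency, so that it is defined for every spanning subgraph;
`signedLap_def` unfolds it for an arbitrary instance. -/
noncomputable def signedLap (ε : ℤ) (H : SimpleGraph V) : Matrix V V ℤ :=
  H.degMatrix ℤ + ε • H.adjMatrix ℤ

theorem signedLap_def (ε : ℤ) (H : SimpleGraph V) [DecidableRel H.Adj] :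
    signedLap ε H = H.degMatrix ℤ + ε • H.adjMatrix ℤ := by
  unfold signedLap
  congr!

theorem signedLap_eq_sum {ε : ℤ} (hε : ε * ε = 1) (H : SimpleGraph V) [DecidableRel H.Adj] :
    signedLap ε H = ∑ e ∈ H.edgeFinset, vecMulVec (edgeVec ε e) (edgeVec ε e) := by
  ext i j
  rw [Matrix.sum_apply]
  simp only [vecMulVec_apply]
  rw [Finset.sum_congr rfl fun e he => edgeVec_mul_edgeVec hε
    (H.not_isDiag_of_mem_edgeFinset he) i j]
  rw [signedLap_def]
  simp only [degMatrix, Matrix.add_apply, Matrix.smul_apply, diagonal_apply,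
    adjMatrix_apply]
  by_cases h : i = j
  · subst h
    simp only [if_true, ← card_incidenceFinset_eq_degree, incidenceFinset_eq_filter]
    simp
  · simp [h]

theorem edgeVec_dotProduct (ε : ℤ) (e : Sym2 V) (x : V → ℤ) :
    edgeVec ε e ⬝ᵥ x = x e.out.1 + ε * x e.out.2 := by
  rw [edgeVec, add_dotProduct, smul_dotProduct, single_one_dotProduct, single_one_dotProduct,
    smul_eq_mul]

theorem signedLap_mulVec_eq_zero {ε : ℤ} (hε : ε * ε = 1) (H : SimpleGraph V) {x : V → ℤ}
    (hx : ∀ a b, H.Adj a b → x a + ε * x b = 0) : signedLap ε H *ᵥ x = 0 := by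
  classical
  rw [signedLap_eq_sum hε, Matrix.sum_mulVec]
  refine Finset.sum_eq_zero fun e he => ?_
  have hadj : H.Adj e.out.1 e.out.2 := by
    rw [← mem_edgeSet, ← mem_edgeFinset]
    convert he
    exact Quot.out_eq e
  rw [vecMulVec_mulVec, edgeVec_dotProduct, hx _ _ hadj, MulOpposite.op_zero, zero_smul]

theorem signedLap_neg_one_mulVec_one (H : SimpleGraph V) :
    signedLap (-1) H *ᵥ (fun _ => 1) = 0 :=
  signedLap_mulVec_eq_zero (by norm_num) H (by simp)

theorem det_signedLap_neg_one [Nonempty V] (H : SimpleGraph V) : (signedLap (-1) H).det = 0 :=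
  exists_mulVec_eq_zero_iff.1 ⟨fun _ => 1, fun h => one_ne_zero (congrFun h (Classical.arbitrary V)),
    signedLap_neg_one_mulVec_one H⟩

omit [DecidableEq V] in
/-- The edge subsets of `G` of size `k` are the edge sets of its spanning subgraphs with `k`
edges. -/
theorem sum_powersetCard_edgeFinset {M : Type*} [AddCommMonoid M] (G : SimpleGraph V)
    [DecidableRel G.Adj] (k : ℕ) (F : SimpleGraph V → M) :
    ∑ S ∈ G.edgeFinset.powersetCard k, F (fromEdgeSet (S : Set (Sym2 V))) =
      ∑ H ∈ (Set.toFinite {H : SimpleGraph V | H ≤ G ∧ H.edgeSet.ncard = k}).toFinset, F H := by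
  classical
  have key : ∀ S : Finset (Sym2 V), S ⊆ G.edgeFinset →
      (fromEdgeSet (S : Set (Sym2 V))).edgeSet = S := by
    intro S hS
    rw [edgeSet_fromEdgeSet, sdiff_eq_left, Set.disjoint_left]
    intro e he
    exact G.not_isDiag_of_mem_edgeFinset (hS he)
  refine Finset.sum_bij (fun S _ => fromEdgeSet (S : Set (Sym2 V))) ?_ ?_ ?_ fun _ _ => rfl
  · intro S hS
    rw [mem_powersetCard] at hS
    rw [Set.Finite.mem_toFinset]
    refine ⟨?_, ?_⟩
    · rw [← edgeSet_subset_edgeSet, key S hS.1]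
      intro e he
      exact mem_edgeFinset.1 (hS.1 he)
    · rw [key S hS.1, Set.ncard_coe_finset, hS.2]
  · intro S hS S' hS' h
    rw [mem_powersetCard] at hS hS'
    have := congrArg edgeSet h
    rw [key S hS.1, key S' hS'.1] at this
    exact_mod_cast this
  · intro H hH
    rw [Set.Finite.mem_toFinset] at hH
    refine ⟨H.edgeFinset, ?_, ?_⟩
    · rw [mem_powersetCard]
      refine ⟨edgeFinset_subset_edgeFinset.2 hH.1, ?_⟩
      rw [← hH.2, ← coe_edgeFinset, Set.ncard_coe_finset]
    · simp

theorem signedLap_fromEdgeSet {ε : ℤ} (hε : ε * ε = 1) {G : SimpleGraph V} [DecidableRel G.Adj]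
    {S : Finset (Sym2 V)} (hS : S ⊆ G.edgeFinset) :
    signedLap ε (fromEdgeSet (S : Set (Sym2 V))) =
      ∑ e ∈ S, vecMulVec (edgeVec ε e) (edgeVec ε e) := by
  classical
  rw [signedLap_eq_sum hε]
  refine Finset.sum_congr ?_ fun _ _ => rfl
  ext e
  simp only [mem_edgeFinset, edgeSet_fromEdgeSet, Set.mem_sdiff, SetLike.mem_coe,
    and_iff_left_iff_imp]
  intro he
  exact G.not_isDiag_of_mem_edgeFinset (hS he)

/-- Cauchy–Binet for `D + ε A`: the determinant is the sum of those of the spanning subgraphs with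
as many edges as vertices. -/
theorem det_signedLap_eq_sum {ε : ℤ} (hε : ε * ε = 1) (G : SimpleGraph V) :
    (signedLap ε G).det =
      ∑ H ∈ (Set.toFinite {H : SimpleGraph V | H ≤ G ∧ H.edgeSet.ncard = Fintype.card V}).toFinset,
        (signedLap ε H).det := by
  classical
  rw [← sum_powersetCard_edgeFinset, signedLap_eq_sum hε, det_sum_vecMulVec]
  refine Finset.sum_congr rfl fun S hS => ?_
  rw [signedLap_fromEdgeSet hε (mem_powersetCard.1 hS).1]

end SignedLaplacian

/-! ### The matrix-tree theorem -/

section MatrixTree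

variable {V : Type*} [Fintype V] [DecidableEq V]

/-- The oriented incidence matrix of `T` with one more column `y`, indexed by `none`. -/
noncomputable def borderedIncidence (T : SimpleGraph V) (y : V → ℤ) :
    Matrix V (Option T.edgeSet) ℤ :=
  Matrix.of fun v o => o.elim (y v) fun e => edgeVec (-1) (e : Sym2 V) v

theorem signedLap_add_vecMulVec (T : SimpleGraph V) [Fintype T.edgeSet] (y : V → ℤ) :
    signedLap (-1) T + vecMulVec y y = borderedIncidence T y * (borderedIncidence T y)ᵀ := by
  classical
  rw [signedLap_eq_sum (by norm_num)]
  ext i j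
  simp only [Matrix.add_apply, Matrix.sum_apply, vecMulVec_apply, Matrix.mul_apply,
    Fintype.sum_option, transpose_apply, borderedIncidence, Matrix.of_apply, Option.elim]
  rw [add_comm, ← Finset.sum_subtype T.edgeFinset (fun e => mem_edgeFinset)
    (fun e => edgeVec (-1) e i * edgeVec (-1) e j)]
  congr!

/-- For connected `T` the oriented incidence vectors together with `e_r` span `ℤ^V`: telescoping
along a walk from `v` to `r` gives `e_v - e_r`. -/
theorem exists_borderedIncidence_mulVec {T : SimpleGraph V} [Fintype T.edgeSet]
    (hT : T.Connected) (r : V) (z : V → ℤ) :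
    ∃ c, borderedIncidence T (Pi.single r 1) *ᵥ c = z := by
  classical
  set M := borderedIncidence T (Pi.single r 1)
  change z ∈ LinearMap.range M.mulVecLin
  have hcol : ∀ o, M.col o ∈ LinearMap.range M.mulVecLin := fun o =>
    ⟨Pi.single o 1, by simp⟩
  have hadj : ∀ a b, T.Adj a b →
      (Pi.single a 1 - Pi.single b 1 : V → ℤ) ∈ LinearMap.range M.mulVecLin := by
    intro a b hab
    have h := hcol (some ⟨s(a, b), hab⟩)
    have h2 : M.col (some ⟨s(a, b), hab⟩) = edgeVec (-1) s(a, b) := rfl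
    have hout : s((s(a, b)).out.1, (s(a, b)).out.2) = s(a, b) := Quot.out_eq _
    rw [h2, edgeVec] at h
    rw [Sym2.eq_iff] at hout
    rcases hout with ⟨h3, h4⟩ | ⟨h3, h4⟩
    · rw [h3, h4] at h
      convert h using 1
      simp [sub_eq_add_neg]
    · rw [h3, h4] at h
      convert neg_mem h using 1
      simp [sub_eq_add_neg]
  have hsingle : ∀ v, (Pi.single v 1 : V → ℤ) ∈ LinearMap.range M.mulVecLin := by
    intro v
    obtain ⟨p⟩ := hT.preconnected v r
    induction p with
    | nil => exact hcol none
    | cons h p ih =>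
      simpa using add_mem (hadj _ _ h) (ih hcol hadj)
  rw [pi_eq_sum_univ z]
  refine sum_mem fun v _ => Submodule.smul_mem _ _ ?_
  convert hsingle v using 2 with w
  simp [Pi.single_apply, eq_comm]

/-- For a tree the incidence matrix bordered by `e_r` is square and has a right inverse over `ℤ`, so
its determinant is `±1`. Replacing the border `e_r` by `y` multiplies the determinant by the
coefficient of `e_r` in `y`, which is the coordinate sum of `y`. -/
theorem det_signedLap_add_vecMulVec_of_isTree {T : SimpleGraph V} (hT : T.IsTree) (y : V → ℤ) :
    (signedLap (-1) T + vecMulVec y y).det = (∑ v, y v) ^ 2 := by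
  classical
  obtain ⟨r⟩ := hT.connected.nonempty
  have hcard : Fintype.card V = Fintype.card (Option T.edgeSet) := by
    rw [Fintype.card_option, ← hT.card_edgeFinset, edgeFinset_card]
  let σ : V ≃ Option T.edgeSet := Fintype.equivOfCardEq hcard
  set M := borderedIncidence T (Pi.single r 1)
  obtain ⟨c, hc⟩ := exists_borderedIncidence_mulVec hT.connected r y
  have hsq : (M.submatrix id σ).det * (M.submatrix id σ).det = 1 := by
    choose X hX using fun v : V => exists_borderedIncidence_mulVec hT.connected r (Pi.single v 1)
    refine Int.isUnit_mul_self ((Matrix.isUnit_iff_isUnit_det _).1 ?_)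
    refine IsUnit.of_mul_eq_one ((Matrix.of X)ᵀ.submatrix σ id) ?_
    rw [submatrix_mul_equiv]
    ext i j
    have := congrFun (hX j) i
    rw [Matrix.one_apply]
    simpa [Matrix.mul_apply, mulVec, dotProduct, Pi.single_apply] using this
  -- Every edge column has coordinate sum zero, so the coordinate sum of `y` is the coefficient of
  -- the border column.
  have hones : (fun _ => 1) ᵥ* M = Pi.single none 1 := by
    ext o
    cases o with
    | none => simp [M, vecMul, dotProduct, borderedIncidence]
    | some e =>
      have h := edgeVec_dotProduct (-1) (e : Sym2 V) (fun _ => 1)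
      rw [dotProduct_comm] at h
      exact h.trans (by simp)
  have hsum : c none = ∑ v, y v := by
    have h : (fun _ => 1) ⬝ᵥ (M *ᵥ c) = c none := by
      rw [dotProduct_mulVec, hones, single_one_dotProduct]
    rw [hc] at h
    rw [← h]
    simp [dotProduct]
  have hfac : borderedIncidence T y = M * (1 : Matrix _ _ ℤ).updateCol none c := by
    rw [mul_updateCol, hc, Matrix.mul_one]
    ext v o
    cases o <;> simp [M, borderedIncidence]
  have hU : ((1 : Matrix _ _ ℤ).updateCol none c).det = ∑ v, y v := by
    rw [← cramer_apply, cramer_one, ← hsum]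
    rfl
  have hdet : ((borderedIncidence T y).submatrix id σ).det =
      (M.submatrix id σ).det * ∑ v, y v := by
    rw [hfac, ← submatrix_mul_equiv _ _ id σ σ, det_mul, det_submatrix_equiv_self, hU]
  have hgram : signedLap (-1) T + vecMulVec y y =
      (borderedIncidence T y).submatrix id σ * ((borderedIncidence T y).submatrix id σ)ᵀ := by
    rw [transpose_submatrix, submatrix_mul_equiv, submatrix_id_id, signedLap_add_vecMulVec]
  rw [hgram, det_mul, det_transpose, hdet, mul_mul_mul_comm, hsq, one_mul, sq]

/-- The indicator vector of a component that misses `r` lies in the kernel. -/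
theorem det_signedLap_add_vecMulVec_of_not_connected {H : SimpleGraph V} (hH : ¬ H.Connected)
    (r : V) : (signedLap (-1) H + vecMulVec (Pi.single r 1) (Pi.single r 1)).det = 0 := by
  classical
  obtain ⟨v, hv⟩ : ∃ v, ¬ H.Reachable r v := by
    by_contra! h
    exact hH ((connected_iff_exists_forall_reachable H).2 ⟨r, h⟩)
  refine exists_mulVec_eq_zero_iff.1 ⟨fun w => if H.Reachable v w then 1 else 0, ?_, ?_⟩
  · intro h
    simpa using congrFun h v
  · rw [add_mulVec, signedLap_mulVec_eq_zero (by norm_num), vecMulVec_mulVec,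
      single_one_dotProduct, if_neg (fun h => hv h.symm)]
    · simp
    · intro a b hab
      have : H.Reachable v a ↔ H.Reachable v b :=
        ⟨fun h => h.trans hab.reachable, fun h => h.trans hab.symm.reachable⟩
      simp only [this]
      split_ifs <;> simp

/-- A form of the matrix-tree theorem: `det (L + e_r e_rᵀ)` is the number of spanning trees. In the
Cauchy–Binet expansion an edge set that leaves out `e_r` contributes the vanishing determinant of a
Laplacian, and one that contains `e_r` contributes `1` for a spanning tree and `0` otherwise. -/
theorem det_signedLap_add_single (G : SimpleGraph V) (r : V) :
    (signedLap (-1) G + vecMulVec (Pi.single r 1) (Pi.single r 1)).det = (complexity G : ℤ) := by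
  classical
  have : Nonempty V := ⟨r⟩
  obtain ⟨k, hk⟩ := Nat.exists_eq_succ_of_ne_zero (Fintype.card_ne_zero (α := V))
  let x : Option (Sym2 V) → V → ℤ := fun o => o.elim (Pi.single r 1) (edgeVec (-1))
  have hx : ∀ S ⊆ G.edgeFinset, ∑ o ∈ insertNone S, vecMulVec (x o) (x o) =
      signedLap (-1) (fromEdgeSet (S : Set (Sym2 V))) +
        vecMulVec (Pi.single r 1) (Pi.single r 1) := by
    intro S hS
    rw [sum_insertNone, signedLap_fromEdgeSet (by norm_num) hS, add_comm]
    rfl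
  have h1 : signedLap (-1) G + vecMulVec (Pi.single r 1) (Pi.single r 1) =
      ∑ o ∈ insertNone G.edgeFinset, vecMulVec (x o) (x o) := by
    rw [hx _ subset_rfl]
    simp
  rw [h1, det_sum_vecMulVec, hk]
  have himg : (G.edgeFinset.powersetCard k).image insertNone ⊆
      (insertNone G.edgeFinset).powersetCard k.succ := by
    intro S hS
    obtain ⟨S', hS', rfl⟩ := mem_image.1 hS
    rw [mem_powersetCard] at hS' ⊢
    exact ⟨insertNone.monotone hS'.1, by rw [card_insertNone, hS'.2]⟩
  rw [← Finset.sum_subset himg, Finset.sum_image insertNone.injective.injOn]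
  · rw [Finset.sum_congr rfl fun S hS => by rw [hx S (mem_powersetCard.1 hS).1]]
    refine (sum_powersetCard_edgeFinset G k fun H =>
      (signedLap (-1) H + vecMulVec (Pi.single r 1) (Pi.single r 1)).det).trans ?_
    have hterm : ∀ H ∈ (Set.toFinite {H : SimpleGraph V | H ≤ G ∧ H.edgeSet.ncard = k}).toFinset,
        (signedLap (-1) H + vecMulVec (Pi.single r 1) (Pi.single r 1)).det =
          if H.IsTree then 1 else 0 := by
      intro H hH
      rw [Set.Finite.mem_toFinset] at hH
      split_ifs with hT
      · rw [det_signedLap_add_vecMulVec_of_isTree hT]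
        simp
      · refine det_signedLap_add_vecMulVec_of_not_connected (fun hc => hT ?_) r
        rw [isTree_iff_connected_and_card]
        refine ⟨hc, ?_⟩
        rw [Nat.card_eq_fintype_card (α := V), hk]
        exact congrArg (· + 1) hH.2
    rw [Finset.sum_congr rfl hterm, ← Finset.sum_filter, Finset.sum_const, nsmul_one, complexity,
      ← Set.ncard_coe_finset]
    congr 2
    ext H
    simp only [coe_filter, Set.Finite.mem_toFinset, Set.mem_ofPred_eq]
    constructor
    · exact fun h => ⟨h.1.1, h.2⟩
    · refine fun h => ⟨⟨h.1, ?_⟩, h.2⟩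
      have := (isTree_iff_connected_and_card.1 h.2).2
      rw [Nat.card_eq_fintype_card (α := V), hk] at this
      exact Nat.succ_injective this
  · intro S hS hS'
    rw [mem_powersetCard] at hS
    have hnone : none ∉ S := by
      intro hn
      refine hS' (mem_image.2 ⟨eraseNone S, ?_, ?_⟩)
      · rw [mem_powersetCard]
        constructor
        · intro e he
          simpa using hS.1 (mem_eraseNone.1 he)
        · have := congrArg card (insertNone_eraseNone S)
          rw [card_insertNone, insert_eq_of_mem hn, hS.2] at this
          exact Nat.succ_injective this
      · rw [insertNone_eraseNone, insert_eq_of_mem hn]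
    have hmap : S = (eraseNone S).map Function.Embedding.some := by
      rw [map_some_eraseNone, erase_eq_of_notMem hnone]
    rw [hmap, sum_map]
    have := signedLap_fromEdgeSet (ε := -1) (by norm_num) (G := G) (S := eraseNone S) (by
      intro e he
      simpa using hS.1 (mem_eraseNone.1 he))
    rw [← det_signedLap_neg_one (fromEdgeSet (eraseNone S : Set (Sym2 V))), this]
    rfl

end MatrixTree

/-! ### Cycles of a tree plus one edge -/

section Cycles

variable {V : Type*} {T K : SimpleGraph V}

/-- `K` contains exactly one cycle, and its number of vertices is odd. -/
def HasUniqueOddCycle (K : SimpleGraph V) : Prop :=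
  ∃ C : K.Subgraph, IsUnorientedCycle C ∧ Odd C.verts.ncard ∧
    ∀ C' : K.Subgraph, IsUnorientedCycle C' → C' = C

theorem ncard_verts_toSubgraph_of_isCycle {v : V} {w : K.Walk v v} (hw : w.IsCycle) :
    w.toSubgraph.verts.ncard = w.length := by
  classical
  have h : w.toSubgraph.verts = (w.support.tail.toFinset : Set V) := by
    ext x
    rw [Walk.mem_verts_toSubgraph, List.coe_toFinset, Set.mem_ofPred_eq]
    refine ⟨fun hx => ?_, List.mem_of_mem_tail⟩
    rcases (Walk.mem_support_iff w).1 hx with rfl | hx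
    · exact Walk.end_mem_tail_support hw.not_nil
    · exact hx
  rw [h, Set.ncard_coe_finset, List.toFinset_card_of_nodup hw.support_nodup, List.length_tail,
    Walk.length_support, Nat.add_sub_cancel]

/-- The fundamental cycle of an edge `ab` outside a spanning tree `T`: the edge followed by the path
of `T` from `b` to `a`. -/
theorem exists_isUnorientedCycle_of_isTree_le (hT : T.IsTree) (hle : T ≤ K) {a b : V}
    (hab : K.Adj a b) (hn : ¬ T.Adj a b) :
    ∃ C : K.Subgraph, IsUnorientedCycle C ∧ s(a, b) ∈ C.edgeSet ∧
      C.edgeSet ⊆ insert s(a, b) T.edgeSet ∧ ∃ p : T.Walk b a, C.verts.ncard = p.length + 1 := by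
  obtain ⟨p, hp, -⟩ := hT.existsUnique_path b a
  have hcyc : (Walk.cons hab (p.mapLe hle)).IsCycle := by
    rw [Walk.cons_isCycle_iff, Walk.isPath_mapLe, Walk.edges_mapLe_eq_edges]
    exact ⟨hp, fun h => hn (p.adj_of_mem_edges h)⟩
  refine ⟨_, ⟨a, _, hcyc, rfl⟩, ?_, ?_, p, ?_⟩
  · rw [Walk.mem_edges_toSubgraph, Walk.edges_cons]
    exact List.mem_cons_self
  · intro e he
    rw [Walk.mem_edges_toSubgraph, Walk.edges_cons, Walk.edges_mapLe_eq_edges, List.mem_cons] at he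
    exact he.imp id fun h => p.edges_subset_edgeSet h
  · rw [ncard_verts_toSubgraph_of_isCycle hcyc, Walk.length_cons, Walk.length_mapLe]

/-- If `K` is a forest `T` plus the edge `ab`, every cycle of `K` uses that edge; after a rotation
and perhaps a reversal it starts with the step from `a` to `b` and continues by a path in `T`. -/
theorem IsUnorientedCycle.exists_cons (hT : T.IsAcyclic) (hle : T ≤ K) {a b : V}
    (hK : K.edgeSet ⊆ insert s(a, b) T.edgeSet) {C : K.Subgraph} (hC : IsUnorientedCycle C) :
    ∃ (h : K.Adj a b) (p : T.Walk b a), p.IsPath ∧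
      C = (Walk.cons h (p.mapLe hle)).toSubgraph := by
  classical
  obtain ⟨v, w, hw, rfl⟩ := hC
  -- A cycle that avoids `ab` would be a cycle of the forest `T`.
  have hmem : s(a, b) ∈ w.edges := by
    by_contra hn
    have hsub : ∀ e ∈ w.edges, e ∈ T.edgeSet := fun e he =>
      (hK (w.edges_subset_edgeSet he)).resolve_left fun h => hn (h ▸ he)
    exact hT _ (hw.transfer hsub)
  have ha : a ∈ w.support := w.fst_mem_support_of_mem_edges hmem
  have hrot : (w.rotate a ha).IsCycle := (Walk.isCycle_rotate _).2 hw
  obtain ⟨c, hc, hsnd, hcw⟩ : ∃ c : K.Walk a a, c.IsCycle ∧ c.snd = b ∧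
      c.toSubgraph = w.toSubgraph := by
    have hb : b ∈ (w.rotate a ha).toSubgraph.neighborSet a := by
      rw [Walk.toSubgraph_rotate, Subgraph.mem_neighborSet, ← Subgraph.mem_edgeSet,
        Walk.mem_edges_toSubgraph]
      exact hmem
    rw [hrot.neighborSet_toSubgraph_endpoint] at hb
    rcases hb with hb | hb
    · exact ⟨_, hrot, hb.symm, Walk.toSubgraph_rotate _ _⟩
    · refine ⟨_, hrot.reverse, ?_, ?_⟩
      · rw [Walk.snd_reverse]
        exact hb.symm
      · rw [Walk.toSubgraph_reverse, Walk.toSubgraph_rotate]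
  cases c with
  | nil => exact absurd hc Walk.not_isCycle_nil
  | cons h q =>
    rw [Walk.snd_cons] at hsnd
    subst hsnd
    rw [Walk.cons_isCycle_iff] at hc
    have hq : ∀ e ∈ q.edges, e ∈ T.edgeSet := fun e he =>
      (hK (q.edges_subset_edgeSet he)).resolve_left fun h => hc.2 (h ▸ he)
    refine ⟨h, q.transfer T hq, hc.1.transfer hq, ?_⟩
    rw [← hcw]
    congr 2
    change q = (q.transfer T hq).map (.ofLE hle)
    rw [← Walk.transfer_eq_map_ofLE _
      (fun e he => edgeSet_mono hle (Walk.edges_subset_edgeSet _ he)), Walk.transfer_transfer,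
      Walk.transfer_self]

theorem IsUnorientedCycle.eq_of_isAcyclic (hT : T.IsAcyclic) (hle : T ≤ K) {a b : V}
    (hK : K.edgeSet ⊆ insert s(a, b) T.edgeSet) {C C' : K.Subgraph} (hC : IsUnorientedCycle C)
    (hC' : IsUnorientedCycle C') : C = C' := by
  obtain ⟨h, p, hp, rfl⟩ := hC.exists_cons hT hle hK
  obtain ⟨h', p', hp', rfl⟩ := hC'.exists_cons hT hle hK
  have : p = p' := congrArg Subtype.val 
    ((hT.subsingleton_path b a).elim ⟨p, hp⟩ ⟨p', hp'⟩)
  rw [this]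

/-- A connected graph with exactly one cycle has exactly one edge outside a spanning tree, since two
such edges would have different fundamental cycles. -/
theorem ncard_edgeSet_of_hasUniqueOddCycle [Finite V] (hK : K.Connected)
    (hC : HasUniqueOddCycle K) : K.edgeSet.ncard = Nat.card V := by
  obtain ⟨C, ⟨v, w, hw, -⟩, -, huniq⟩ := hC
  obtain ⟨T, hle, hT⟩ := hK.exists_isTree_le
  have hTcard : T.edgeSet.ncard + 1 = Nat.card V := (isTree_iff_connected_and_card.1 hT).2
  have hsub : T.edgeSet ⊆ K.edgeSet := edgeSet_mono hle
  have hone : (K.edgeSet \ T.edgeSet).ncard = 1 := by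
    rw [Set.ncard_eq_one]
    have hne : (K.edgeSet \ T.edgeSet).Nonempty := by
      rw [Set.nonempty_iff_ne_empty, Ne, Set.sdiff_eq_empty]
      intro h
      have hKT : K = T := le_antisymm (edgeSet_subset_edgeSet.1 h) hle
      exact (hKT ▸ hT.isAcyclic) w hw
    obtain ⟨e, he⟩ := hne
    refine ⟨e, Set.Subset.antisymm ?_ (Set.singleton_subset_iff.2 he)⟩
    rintro e' he'
    induction e using Sym2.ind with | _ a b =>
    induction e' using Sym2.ind with | _ a' b' =>
    obtain ⟨C₁, hC₁, -, h₁, -⟩ := exists_isUnorientedCycle_of_isTree_le hT hle he.1 he.2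
    obtain ⟨C₂, hC₂, h₂, -, -⟩ := exists_isUnorientedCycle_of_isTree_le hT hle he'.1 he'.2
    rw [huniq C₂ hC₂, ← huniq C₁ hC₁] at h₂
    exact (h₁ h₂).resolve_right he'.2
  have := Set.ncard_sdiff_add_ncard_of_subset hsub
  omega

end Cycles

/-! ### The signless Laplacian of a connected graph -/

section Unicyclic

variable {V : Type*} [DecidableEq V]

omit [DecidableEq V] in
theorem exists_coloring_bool {H : SimpleGraph V} (hH : H.IsBipartite) :
    Nonempty (H.Coloring Bool) :=
  ⟨Colorable.toColoring hH (by simp)⟩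

/-- The function that is `1` on one colour class and `-1` on the other. -/
def signOf (R : Type*) [Ring R] {H : SimpleGraph V} (c : H.Coloring Bool) (v : V) : R :=
  if c v then 1 else -1

omit [DecidableEq V] in
theorem signOf_mul_self (R : Type*) [Ring R] {H : SimpleGraph V} (c : H.Coloring Bool) (v : V) :
    signOf R c v * signOf R c v = 1 := by
  unfold signOf
  split_ifs <;> simp

theorem diagonal_signOf_mul_self (R : Type*) [Ring R] [Fintype V] {H : SimpleGraph V}
    (c : H.Coloring Bool) : diagonal (signOf R c) * diagonal (signOf R c) = 1 := by
  simp [diagonal_mul_diagonal, signOf_mul_self]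

theorem det_diagonal_signOf_conj (R : Type*) [CommRing R] [Fintype V] {H : SimpleGraph V}
    (c : H.Coloring Bool) (M : Matrix V V R) :
    (diagonal (signOf R c) * M * diagonal (signOf R c)).det = M.det := by
  rw [det_mul, det_mul, mul_right_comm, ← det_mul, diagonal_signOf_mul_self, det_one, one_mul]

theorem diagonal_signOf_conj_diagonal (R : Type*) [CommRing R] [Fintype V] {H : SimpleGraph V}
    (c : H.Coloring Bool) (d : V → R) :
    diagonal (signOf R c) * diagonal d * diagonal (signOf R c) = diagonal d := by
  rw [diagonal_mul_diagonal, diagonal_mul_diagonal]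
  congr 1
  ext v
  rw [mul_right_comm, signOf_mul_self, one_mul]

theorem diagonal_signOf_conj_adjMatrix (R : Type*) [CommRing R] [Fintype V] {H : SimpleGraph V}
    [DecidableRel H.Adj] (c : H.Coloring Bool) :
    diagonal (signOf R c) * H.adjMatrix R * diagonal (signOf R c) = -H.adjMatrix R := by
  ext v w
  rw [mul_diagonal, diagonal_mul, Matrix.neg_apply, adjMatrix_apply]
  split_ifs with h
  · have := c.valid h
    unfold signOf
    cases hv : c v <;> cases hw : c w <;> simp_all
  · simp

/-- For a bipartite graph the signless Laplacian and the Laplacian are conjugate by a diagonal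
matrix of signs. -/
theorem diagonal_signOf_conj_signedLap [Fintype V] {H : SimpleGraph V} (c : H.Coloring Bool) :
    diagonal (signOf ℤ c) * signedLap 1 H * diagonal (signOf ℤ c) = signedLap (-1) H := by
  classical
  rw [signedLap_def, signedLap_def, one_smul, Matrix.mul_add, Matrix.add_mul,
    diagonal_signOf_conj_adjMatrix, degMatrix, diagonal_signOf_conj_diagonal, neg_one_smul]

variable [Fintype V]

theorem det_signedLap_one_of_isBipartite [Nonempty V] {H : SimpleGraph V} (hH : H.IsBipartite) :
    (signedLap 1 H).det = 0 := by
  obtain ⟨c⟩ := exists_coloring_bool hH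
  rw [← det_diagonal_signOf_conj ℤ c, diagonal_signOf_conj_signedLap, det_signedLap_neg_one]

/-- A connected graph with fewer edges than vertices is a tree, hence bipartite. -/
theorem det_signedLap_one_of_ncard_lt {K : SimpleGraph V} (hK : K.Connected)
    (hcard : K.edgeSet.ncard < Fintype.card V) : (signedLap 1 K).det = 0 := by
  have := hK.nonempty
  refine det_signedLap_one_of_isBipartite (IsTree.isBipartite ?_)
  refine isTree_iff_connected_and_card.2 ⟨hK, le_antisymm ?_ ?_⟩
  · rw [Nat.card_eq_fintype_card (α := V)]
    exact hcard
  · exact hK.card_vert_le_card_edgeSet_add_one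

open Classical in
/-- Write `K` as a spanning tree `T` plus an edge `ab`, and let `s` be the signs of the colouring of
`T`. Conjugating by `s` turns the signless Laplacian of `K` into the Laplacian of `T` plus the
square of a vector with coordinate sum `s a + s b`. This sum is `±2` or `0` according as the
fundamental cycle of `ab` is odd or even. -/
theorem det_signedLap_one_of_ncard_eq {K : SimpleGraph V} (hK : K.Connected)
    (hcard : K.edgeSet.ncard = Fintype.card V) :
    (signedLap 1 K).det = if HasUniqueOddCycle K then 4 else 0 := by
  obtain ⟨T, hle, hT⟩ := hK.exists_isTree_le
  have hTcard : T.edgeSet.ncard + 1 = Nat.card V := (isTree_iff_connected_and_card.1 hT).2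
  have hsub : T.edgeSet ⊆ K.edgeSet := edgeSet_mono hle
  obtain ⟨e, he⟩ : ∃ e, K.edgeSet \ T.edgeSet = {e} := by
    rw [← Set.ncard_eq_one]
    have := Set.ncard_sdiff_add_ncard_of_subset hsub
    rw [Nat.card_eq_fintype_card] at hTcard
    omega
  induction e using Sym2.ind with | _ a b =>
  have heK : s(a, b) ∈ K.edgeSet \ T.edgeSet := he ▸ rfl
  have hins : K.edgeSet = insert s(a, b) T.edgeSet := by
    rw [← Set.sdiff_union_of_subset hsub, he, Set.singleton_union]
  obtain ⟨C, hC, -, -, p, hp⟩ := exists_isUnorientedCycle_of_isTree_le hT hle heK.1 heK.2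
  obtain ⟨c⟩ := exists_coloring_bool hT.isBipartite
  have hQ : signedLap 1 K =
      signedLap 1 T + vecMulVec (edgeVec 1 s(a, b)) (edgeVec 1 s(a, b)) := by
    have h : K.edgeFinset = insert s(a, b) T.edgeFinset := by
      ext e
      simp [hins]
    rw [signedLap_eq_sum (by norm_num), h, sum_insert (by simpa using heK.2), add_comm,
      signedLap_eq_sum (by norm_num)]
  have hdet : (signedLap 1 K).det = (signOf ℤ c a + signOf ℤ c b) ^ 2 := by
    rw [← det_diagonal_signOf_conj ℤ c, hQ, Matrix.mul_add, Matrix.add_mul,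
      diagonal_signOf_conj_signedLap, mul_vecMulVec, vecMulVec_mul, ← mulVec_transpose,
      diagonal_transpose, det_signedLap_add_vecMulVec_of_isTree hT]
    congr 1
    have h : ∑ v, (diagonal (signOf ℤ c) *ᵥ edgeVec 1 s(a, b)) v =
        edgeVec 1 s(a, b) ⬝ᵥ signOf ℤ c := by
      simp [mulVec_diagonal, dotProduct, mul_comm]
    rw [h, edgeVec_dotProduct, one_mul]
    have hout : s((s(a, b)).out.1, (s(a, b)).out.2) = s(a, b) := Quot.out_eq _
    rcases Sym2.eq_iff.1 hout with ⟨h3, h4⟩ | ⟨h3, h4⟩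
    · rw [h3, h4]
    · rw [h3, h4, add_comm]
  have hodd : HasUniqueOddCycle K ↔ (c a ↔ c b) := by
    have hp' := c.even_length_iff_congr p
    have : HasUniqueOddCycle K ↔ Odd C.verts.ncard := by
      constructor
      · rintro ⟨C', -, hC'odd, huniq⟩
        rwa [huniq C hC]
      · exact fun h => ⟨C, hC, h, fun C' hC' =>
          hC'.eq_of_isAcyclic hT.isAcyclic hle hins.subset hC⟩
    rw [this, hp, Nat.odd_add_one, Nat.not_odd_iff_even, hp']
    tauto
  rw [hdet]
  unfold signOf
  cases ha : c a <;> cases hb : c b <;> simp [hodd, ha, hb]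

end Unicyclic

/-! ### Decomposition into connected components -/

section Components

variable {V : Type*} {H : SimpleGraph V}

theorem subgraph_map_injective {W : Type*} {K : SimpleGraph W} {f : K →g H}
    (hf : Function.Injective f) : Function.Injective (Subgraph.map f) := by
  intro C C' h
  ext v w
  · have := congrArg Subgraph.verts h
    exact iff_of_eq (congrArg (v ∈ ·) (hf.image_injective this))
  · have key : ∀ D : K.Subgraph, D.Adj v w ↔ (D.map f).Adj (f v) (f w) := by
      intro D
      simp [Relation.map_apply, hf.eq_iff]
    rw [key, key, h]

theorem isUnorientedCycle_map {W : Type*} {K : SimpleGraph W} {f : K →g H}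
    (hf : Function.Injective f) {C : K.Subgraph} (hC : IsUnorientedCycle C) :
    IsUnorientedCycle (C.map f) := by
  obtain ⟨v, w, hw, rfl⟩ := hC
  exact ⟨f v, w.map f, hw.map hf, Walk.toSubgraph_map f w⟩

theorem exists_isUnorientedCycle_induce {s : Set V} {C : H.Subgraph} (hC : IsUnorientedCycle C)
    (hs : C.verts ⊆ s) : ∃ C₀ : (H.induce s).Subgraph, IsUnorientedCycle C₀ ∧
      C₀.map (Embedding.induce s).toHom = C := by
  obtain ⟨v, w, hw, rfl⟩ := hC
  have hsupp : ∀ x ∈ w.support, x ∈ s := fun x hx => hs (w.mem_verts_toSubgraph.2 hx)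
  have hmap := Walk.map_induce w hsupp
  refine ⟨(w.induce s hsupp).toSubgraph, ⟨_, _, ?_, rfl⟩, ?_⟩
  · refine (Walk.isCycle_map_iff_of_injective (f := (Embedding.induce s).toHom)
      (Embedding.induce (G := H) s).injective).1 ?_
    rw [hmap]
    exact hw
  · rw [← Walk.toSubgraph_map, hmap]
    rfl

/-- Cycles inside a component are the cycles of the graph induced on it. -/
theorem isOddUnicyclic_iff :
    IsOddUnicyclic H ↔ ∀ c : H.ConnectedComponent, HasUniqueOddCycle (H.induce c.supp) := by
  refine forall_congr' fun c => ?_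
  have hf : Function.Injective (Embedding.induce (G := H) c.supp).toHom :=
    (Embedding.induce (G := H) c.supp).injective
  have hverts : ∀ C : (H.induce c.supp).Subgraph,
      (C.map (Embedding.induce c.supp).toHom).verts ⊆ c.supp := by
    rintro C _ ⟨v, -, rfl⟩
    exact v.2
  constructor
  · rintro ⟨C, ⟨hC, hCc⟩, hodd, huniq⟩
    obtain ⟨C₀, hC₀, rfl⟩ := exists_isUnorientedCycle_induce hC hCc
    refine ⟨C₀, hC₀, ?_, fun C' hC' => ?_⟩
    · rwa [Subgraph.map_verts, Set.ncard_image_of_injective _ hf] at hodd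
    · exact subgraph_map_injective hf (huniq _ (isUnorientedCycle_map hf hC') (hverts C'))
  · rintro ⟨C₀, hC₀, hodd, huniq⟩
    refine ⟨_, ⟨isUnorientedCycle_map hf hC₀, hverts C₀⟩, ?_, fun C' hC' hC'c => ?_⟩
    · rwa [Subgraph.map_verts, Set.ncard_image_of_injective _ hf]
    · obtain ⟨C₁, hC₁, rfl⟩ := exists_isUnorientedCycle_induce hC' hC'c
      rw [huniq C₁ hC₁]

variable [Fintype V] [DecidableEq V]

open Classical in
theorem degree_induce_supp (c : H.ConnectedComponent) (v : c.supp) :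
    (H.induce c.supp).degree v = H.degree v := by
  refine degree_induce_of_neighborSet_subset fun w hw => ?_
  exact c.mem_supp_of_adj_mem_supp v.2 hw

open Classical in
theorem signedLap_induce_supp (ε : ℤ) (c : H.ConnectedComponent) :
    signedLap ε (H.induce c.supp) = (signedLap ε H).submatrix Subtype.val Subtype.val := by
  classical
  ext v w
  rw [signedLap_def, signedLap_def, submatrix_apply]
  simp only [Matrix.add_apply, Matrix.smul_apply, degMatrix, diagonal_apply, degree_induce_supp,
    adjMatrix_apply, Subtype.ext_iff, induce_adj]

open Classical in
/-- `D + ε A` is block diagonal with respect to the components. -/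
theorem det_signedLap_eq_prod (ε : ℤ) (H : SimpleGraph V) :
    (signedLap ε H).det = ∏ᶠ c : H.ConnectedComponent, (signedLap ε (H.induce c.supp)).det := by
  classical
  let : LinearOrder H.ConnectedComponent := linearOrderOfSTO WellOrderingRel
  have htri : BlockTriangular (signedLap ε H) H.connectedComponentMk := by
    intro v w hvw
    have hne : H.connectedComponentMk v ≠ H.connectedComponentMk w := hvw.ne'
    have h1 : v ≠ w := fun h => hne (by rw [h])
    have h2 : ¬ H.Adj v w := fun h => hne (ConnectedComponent.sound h.reachable)
    rw [signedLap_def, Matrix.add_apply, Matrix.smul_apply, degMatrix, diagonal_apply_ne _ h1,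
      adjMatrix_apply, if_neg h2, smul_zero, add_zero]
  rw [finprod_eq_prod_of_fintype, htri.det_fintype]
  refine Finset.prod_congr rfl fun c _ => ?_
  rw [signedLap_induce_supp, ← det_submatrix_equiv_self
    (Equiv.subtypeEquivRight fun v => (c.mem_supp_iff v).symm)]
  congr!

theorem sum_ncard_edgeSet_induce_supp [Fintype H.ConnectedComponent] :
    ∑ c : H.ConnectedComponent, (H.induce c.supp).edgeSet.ncard = H.edgeSet.ncard := by
  classical
  have key : ∀ {W : Type _} [Fintype W] (K : SimpleGraph W),
      2 * K.edgeSet.ncard = ∑ v, K.degree v := by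
    intro W _ K
    rw [K.sum_degrees_eq_twice_card_edges, ← coe_edgeFinset, Set.ncard_coe_finset]
  refine Nat.eq_of_mul_eq_mul_left two_pos ?_
  rw [key H, mul_sum, ← Finset.sum_fiberwise (g := H.connectedComponentMk)]
  refine Finset.sum_congr rfl fun c _ => ?_
  rw [key, Finset.sum_subtype (p := fun v => v ∈ c.supp)]
  · exact Finset.sum_congr rfl fun v _ => degree_induce_supp c v
  · simp

omit [DecidableEq V] in
theorem sum_card_supp [Fintype H.ConnectedComponent] :
    ∑ c : H.ConnectedComponent, Nat.card c.supp = Fintype.card V := by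
  classical
  rw [Fintype.card, card_eq_sum_card_fiberwise (f := H.connectedComponentMk) (t := univ) (by simp)]
  refine Finset.sum_congr rfl fun c _ => ?_
  rw [← Set.ncard_coe_finset]
  change c.supp.ncard = _
  congr 1
  ext v
  simp

omit [Fintype V] [DecidableEq V] in
theorem connected_induce_supp (c : H.ConnectedComponent) : (H.induce c.supp).Connected :=
  c.connected_toSimpleGraph

theorem ncard_edgeSet_of_isOddUnicyclic (hH : IsOddUnicyclic H) :
    H.edgeSet.ncard = Fintype.card V := by
  classical
  rw [← sum_ncard_edgeSet_induce_supp, ← sum_card_supp (H := H)]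
  refine Finset.sum_congr rfl fun c _ => ?_
  exact ncard_edgeSet_of_hasUniqueOddCycle (connected_induce_supp c) (isOddUnicyclic_iff.1 hH c)

open Classical in
/-- If some component has fewer edges than vertices, it is a tree and both sides vanish. Otherwise,
since the totals agree, every component has as many edges as vertices and contributes `4` or `0`. -/
theorem det_signedLap_one_of_ncard_edgeSet (hcard : H.edgeSet.ncard = Fintype.card V) :
    (signedLap 1 H).det = if IsOddUnicyclic H then 4 ^ numComponents H else 0 := by
  rw [det_signedLap_eq_prod, finprod_eq_prod_of_fintype]
  by_cases hlt : ∃ c : H.ConnectedComponent,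
      (H.induce c.supp).edgeSet.ncard < Fintype.card c.supp
  · obtain ⟨c, hc⟩ := hlt
    rw [Finset.prod_eq_zero (mem_univ c)
      (det_signedLap_one_of_ncard_lt (connected_induce_supp c) hc), if_neg]
    intro hH
    have := ncard_edgeSet_of_hasUniqueOddCycle (connected_induce_supp c)
      (isOddUnicyclic_iff.1 hH c)
    rw [Nat.card_eq_fintype_card] at this
    exact hc.ne this
  · push Not at hlt
    have heq : ∀ c ∈ (univ : Finset H.ConnectedComponent),
        Fintype.card c.supp = (H.induce c.supp).edgeSet.ncard := by
      refine (Finset.sum_eq_sum_iff_of_le fun c _ => hlt c).1 ?_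
      rw [sum_ncard_edgeSet_induce_supp, hcard, ← sum_card_supp (H := H)]
      simp_rw [Nat.card_eq_fintype_card]
    rw [Finset.prod_congr rfl fun c hc =>
      det_signedLap_one_of_ncard_eq (connected_induce_supp c) (heq c hc).symm]
    split_ifs with hH
    · rw [Finset.prod_congr rfl fun c _ => if_pos (isOddUnicyclic_iff.1 hH c), prod_const,
        numComponents, Nat.card_eq_fintype_card, card_univ]
    · rw [isOddUnicyclic_iff] at hH
      push Not at hH
      obtain ⟨c, hc⟩ := hH
      exact Finset.prod_eq_zero (mem_univ c) (if_neg hc)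

/-- The signless Laplacian has determinant `∑ 4 ^ ω(H)` over the odd-unicyclic factors `H`. -/
theorem det_signedLap_one (G : SimpleGraph V) : (signedLap 1 G).det = (iota G : ℤ) := by
  classical
  rw [det_signedLap_eq_sum (by norm_num), iota, Nat.cast_sum]
  rw [Finset.sum_congr rfl fun H hH => det_signedLap_one_of_ncard_edgeSet
    ((Set.Finite.mem_toFinset _).1 hH).2, ← Finset.sum_filter]
  refine Finset.sum_congr ?_ fun H _ => by push_cast; rfl
  ext H
  simp only [mem_filter, Set.Finite.mem_toFinset]
  exact ⟨fun h => ⟨h.1.1, h.2⟩, fun h => ⟨⟨h.1, ncard_edgeSet_of_isOddUnicyclic h.2⟩, h.2⟩⟩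

end Components

/-! ### Derivatives at one half -/

section Analysis

variable {V : Type*} [Fintype V] [DecidableEq V]

theorem analyticAt_det {M : ℂ → Matrix V V ℂ} {x : ℂ}
    (hM : ∀ i j, AnalyticAt ℂ (fun t => M t i j) x) : AnalyticAt ℂ (fun t => (M t).det) x := by
  simp_rw [det_apply']
  exact Finset.analyticAt_fun_sum _ fun σ _ =>
    analyticAt_const.mul (Finset.analyticAt_fun_prod _ fun i _ => hM _ _)

/-- Jacobi's formula, with the derivative placed in one column at a time. -/
theorem hasDerivAt_det {M : ℂ → Matrix V V ℂ} {M' : Matrix V V ℂ} {x : ℂ}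
    (hM : ∀ i j, HasDerivAt (fun t => M t i j) (M' i j) x) :
    HasDerivAt (fun t => (M t).det) (∑ j, ((M x).updateCol j (M'.col j)).det) x := by
  simp_rw [det_apply']
  rw [Finset.sum_comm]
  refine HasDerivAt.fun_sum fun σ _ => ?_
  have h := HasDerivAt.fun_finsetProd (u := univ) (f := fun i t => M t (σ i) i)
    (f' := fun i => M' (σ i) i) (x := x) fun i _ => hM (σ i) i
  refine (h.const_mul _).congr_deriv ?_
  rw [mul_sum]
  refine Finset.sum_congr rfl fun j _ => ?_
  congr 1
  rw [← Finset.prod_erase_mul _ _ (mem_univ j), updateCol_self, smul_eq_mul]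
  congr 1
  exact Finset.prod_congr rfl fun i hi => (updateCol_ne (ne_of_mem_erase hi)).symm

theorem det_add_vecMulVec_single {R : Type*} [CommRing R] (A : Matrix V V R) (v : V) :
    (A + vecMulVec (Pi.single v 1) (Pi.single v 1)).det =
      A.det + (A.updateCol v (Pi.single v 1)).det := by
  have h : A + vecMulVec (Pi.single v 1) (Pi.single v 1) =
      A.updateCol v (A.col v + Pi.single v 1) := by
    ext i j
    rcases eq_or_ne j v with rfl | hj
    · simp [vecMulVec_apply]
    · simp [vecMulVec_apply, hj]
  rw [h, det_updateCol_add]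
  congr 2
  ext i j
  rcases eq_or_ne j v with rfl | hj
  · simp
  · simp [hj]

variable (G : SimpleGraph V) [DecidableRel G.Adj]

theorem map_signedLap (ε : ℤ) :
    (signedLap ε G).map (Int.castRingHom ℂ) = G.degMatrix ℂ + (ε : ℂ) • G.adjMatrix ℂ := by
  ext i j
  rw [signedLap_def]
  simp only [map_apply, Matrix.add_apply, Matrix.smul_apply, degMatrix, diagonal_apply,
    adjMatrix_apply]
  split_ifs <;> simp

omit [DecidableRel G.Adj] in
/-- The diagonal cofactors of the Laplacian are all equal to the number of spanning trees. -/
theorem cramer_map_signedLap_neg_one (v : V) :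
    cramer ((signedLap (-1) G).map (Int.castRingHom ℂ)) (Pi.single v 1) v = complexity G := by
  have : Nonempty V := ⟨v⟩
  have h := det_signedLap_add_single G v
  rw [det_add_vecMulVec_single, det_signedLap_neg_one, zero_add] at h
  have h2 := congrArg (Int.castRingHom ℂ) h
  rw [RingHom.map_det, RingHom.mapMatrix_apply, map_updateCol] at h2
  rw [cramer_apply]
  convert h2 using 3
  · ext w
    simp [Pi.single_apply, apply_ite (Int.cast : ℤ → ℂ)]
  · simp

theorem half_matrix_sub {s : ℂ → ℂ} (hs : s (1 / 2) = 1 / 2) :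
    1 - s (1 / 2) • G.adjMatrix ℂ + (1 / 2 : ℂ) • (G.degMatrix ℂ - (2 : ℂ) • (1 : Matrix V V ℂ)) =
      (1 / 2 : ℂ) • (signedLap (-1) G).map (Int.castRingHom ℂ) := by
  rw [map_signedLap, hs]
  push_cast
  module

theorem half_matrix_add {s : ℂ → ℂ} (hs : s (1 / 2) = 1 / 2) :
    1 + s (1 / 2) • G.adjMatrix ℂ + (1 / 2 : ℂ) • (G.degMatrix ℂ - (2 : ℂ) • (1 : Matrix V V ℂ)) =
      (1 / 2 : ℂ) • (signedLap 1 G).map (Int.castRingHom ℂ) := by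
  rw [map_signedLap, hs]
  push_cast
  module

theorem hG_half {s : ℂ → ℂ} (hs : s (1 / 2) = 1 / 2) [Nonempty V] : hG G s (1 / 2) = 0 := by
  rw [hG, half_matrix_sub G hs, det_smul, ← RingHom.mapMatrix_apply, ← RingHom.map_det,
    det_signedLap_neg_one, map_zero, mul_zero]

theorem lG_half {s : ℂ → ℂ} (hs : s (1 / 2) = 1 / 2) :
    lG G s (1 / 2) = (1 / 2) ^ Fintype.card V * iota G := by
  rw [lG, half_matrix_add G hs, det_smul, ← RingHom.mapMatrix_apply, ← RingHom.map_det,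
    det_signedLap_one]
  simp

/-- Since `s' (1/2) = 0`, the matrix of `h_G` has derivative `D - 2 I` at `1/2`, which is diagonal: so
only the diagonal cofactors of `L / 2` enter, and `∑ v, (deg v - 2) = 2 (m - n)`. -/
theorem hasDerivAt_hG_half {s : ℂ → ℂ} (hs : s (1 / 2) = 1 / 2) (hs' : HasDerivAt s 0 (1 / 2)) :
    HasDerivAt (hG G s) ((1 / 2) ^ (Fintype.card V - 1) * complexity G *
      (2 * ((G.edgeFinset.card : ℂ) - Fintype.card V))) (1 / 2) := by
  have hder := hasDerivAt_det (x := 1 / 2)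
    (M := fun u => 1 - s u • G.adjMatrix ℂ + u • (G.degMatrix ℂ - (2 : ℂ) • (1 : Matrix V V ℂ)))
    (M' := G.degMatrix ℂ - (2 : ℂ) • (1 : Matrix V V ℂ)) (fun i j => by
      have h1 : HasDerivAt (fun u => (1 : Matrix V V ℂ) i j - s u * G.adjMatrix ℂ i j +
          u * (G.degMatrix ℂ - (2 : ℂ) • (1 : Matrix V V ℂ)) i j)
          (0 - 0 * G.adjMatrix ℂ i j +
            1 * (G.degMatrix ℂ - (2 : ℂ) • (1 : Matrix V V ℂ)) i j) (1 / 2) :=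
        ((hasDerivAt_const _ _).sub (hs'.mul_const _)).add ((hasDerivAt_id _).mul_const _)
      simpa using h1)
  refine hder.congr_deriv ?_
  rw [half_matrix_sub G hs]
  have hcol : ∀ v : V, (G.degMatrix ℂ - (2 : ℂ) • (1 : Matrix V V ℂ)).col v =
      ((G.degree v : ℂ) - 2) • Pi.single v 1 := by
    intro v
    ext w
    rcases eq_or_ne w v with rfl | hw
    · simp [degMatrix]
    · simp [degMatrix, hw]
  have hterm : ∀ v : V, (((1 / 2 : ℂ) • (signedLap (-1) G).map (Int.castRingHom ℂ)).updateCol v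
      ((G.degMatrix ℂ - (2 : ℂ) • (1 : Matrix V V ℂ)).col v)).det =
      ((1 / 2) ^ (Fintype.card V - 1) * complexity G) * ((G.degree v : ℂ) - 2) := by
    intro v
    rw [hcol, ← cramer_apply, map_smul, cramer_smul, Pi.smul_apply, LinearMap.smul_apply,
      Pi.smul_apply, cramer_map_signedLap_neg_one, smul_eq_mul, smul_eq_mul]
    ring
  simp_rw [hterm]
  rw [← mul_sum, sum_sub_distrib, ← Nat.cast_sum, G.sum_degrees_eq_twice_card_edges, sum_const,
    card_univ, nsmul_eq_mul]
  push_cast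
  ring

/-- For bipartite `G`, conjugation by the signs of a colouring turns `A` into `-A`. -/
theorem hG_eq_lG_of_isBipartite (hG' : G.IsBipartite) (s : ℂ → ℂ) : hG G s = lG G s := by
  obtain ⟨c⟩ := exists_coloring_bool hG'
  ext u
  have hd : (1 : Matrix V V ℂ) + u • (G.degMatrix ℂ - (2 : ℂ) • (1 : Matrix V V ℂ)) =
      diagonal fun v => 1 + u * (G.degree v - 2) := by
    ext i j
    rcases eq_or_ne i j with rfl | hij
    · simp [degMatrix]
    · simp [degMatrix, hij]
  rw [hG, lG, ← det_diagonal_signOf_conj ℂ c, sub_add_eq_add_sub, add_right_comm, hd,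
    Matrix.mul_sub, Matrix.sub_mul, diagonal_signOf_conj_diagonal, Matrix.mul_smul,
    Matrix.smul_mul, diagonal_signOf_conj_adjMatrix, smul_neg, sub_neg_eq_add]

theorem analyticAt_hG {s : ℂ → ℂ} {x : ℂ} (hs : AnalyticAt ℂ s x) : AnalyticAt ℂ (hG G s) x := by
  refine analyticAt_det fun i j => ?_
  simp only [Matrix.add_apply, Matrix.sub_apply, Matrix.smul_apply, smul_eq_mul]
  fun_prop

theorem analyticAt_lG {s : ℂ → ℂ} {x : ℂ} (hs : AnalyticAt ℂ s x) : AnalyticAt ℂ (lG G s) x := by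
  refine analyticAt_det fun i j => ?_
  simp only [Matrix.add_apply, Matrix.smul_apply, smul_eq_mul]
  fun_prop

/-- `p_G` does not change when `√(u(1-u))` changes sign: the two factors are exchanged. -/
theorem pG_congr {r s : ℂ → ℂ} {u : ℂ} (h : r u ^ 2 = s u ^ 2) : pG G r u = pG G s u := by
  unfold pG hG lG
  rcases sq_eq_sq_iff_eq_or_eq_neg.1 h with h | h
  · rw [h]
  · rw [h, neg_smul, sub_neg_eq_add, ← sub_eq_add_neg, mul_comm]

/-- A branch of `√(u(1-u))` analytic at `1/2`, with value `1/2` and derivative `0` there. -/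
theorem exists_analyticAt_sqrt : ∃ s : ℂ → ℂ, AnalyticAt ℂ s (1 / 2) ∧ s (1 / 2) = 1 / 2 ∧
    HasDerivAt s 0 (1 / 2) ∧ ∀ u, s u ^ 2 = u * (1 - u) := by
  -- The factor `4` puts the base at `1` for `u = 1/2`, so that the value there is evident.
  let s : ℂ → ℂ := fun u => 1 / 2 * (4 * u * (1 - u)) ^ (((2 : ℕ) : ℂ)⁻¹)
  have hval : 4 * (1 / 2 : ℂ) * (1 - 1 / 2) = 1 := by norm_num
  have han : AnalyticAt ℂ s (1 / 2) := by
    refine analyticAt_const.mul (AnalyticAt.cpow (by fun_prop) analyticAt_const ?_)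
    rw [hval]
    exact Complex.one_mem_slitPlane
  have hhalf : s (1 / 2) = 1 / 2 := by
    simp only [s, hval, Complex.one_cpow, mul_one]
  have hsq : ∀ u, s u ^ 2 = u * (1 - u) := by
    intro u
    simp only [s, mul_pow, Complex.cpow_nat_inv_pow _ two_ne_zero]
    ring
  refine ⟨s, han, hhalf, ?_, hsq⟩
  have hd := han.differentiableAt.hasDerivAt
  have h1 : HasDerivAt (fun u => s u ^ 2) (2 * s (1 / 2) ^ (2 - 1) * deriv s (1 / 2)) (1 / 2) := by
    simpa using hd.fun_pow 2
  have h2 : HasDerivAt (fun u : ℂ => s u ^ 2) (1 * (1 - 1 / 2) + 1 / 2 * (-1)) (1 / 2) := by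
    simp_rw [hsq]
    exact (hasDerivAt_id _).mul ((hasDerivAt_id _).const_sub 1)
  -- Differentiating `s ^ 2 = u (1 - u)` at `1/2` gives `2 * (1/2) * s' = 0`.
  have h3 := h1.unique h2
  rw [hhalf] at h3
  have h4 : deriv s (1 / 2) = 0 := by
    norm_num at h3
    norm_num [h3]
  rwa [h4] at hd

end Analysis

end QWZeta

theorem theorem3p4 {V : Type*} [Fintype V] [DecidableEq V]
    (G : SimpleGraph V) [DecidableRel G.Adj]
    (hconn : G.Connected) (hdeg : 3 ≤ G.minDegree)
    (n m : ℕ) (hn : n = Fintype.card V) (hm : m = G.edgeFinset.card)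
    (r : ℂ → ℂ) (hr : ∀ᶠ u in nhds (1 / 2 : ℂ), r u ^ 2 = u * (1 - u)) :
    AnalyticAt ℂ (QWZeta.pG G r) (1 / 2) ∧
    QWZeta.pG G r (1 / 2) = 0 ∧
    (¬ G.IsBipartite →
      deriv (QWZeta.pG G r) (1 / 2) =
        ((m : ℂ) - (n : ℂ)) / (2 : ℂ) ^ (2 * n - 2 : ℤ) *
          (QWZeta.complexity G : ℂ) * (QWZeta.iota G : ℂ)) ∧
    (G.IsBipartite →
      deriv (QWZeta.pG G r) (1 / 2) = 0 ∧
      iteratedDeriv 2 (QWZeta.pG G r) (1 / 2) =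
        ((m : ℂ) - (n : ℂ)) ^ 2 / (2 : ℂ) ^ (2 * n - 5 : ℤ) *
          (QWZeta.complexity G : ℂ) ^ 2) := by
  have := hconn.nonempty
  obtain ⟨s, hs, hhalf, hs', hsq⟩ := QWZeta.exists_analyticAt_sqrt
  have hp : QWZeta.pG G r =ᶠ[nhds (1 / 2)] QWZeta.hG G s * QWZeta.lG G s := by
    filter_upwards [hr] with u hu
    exact QWZeta.pG_congr G (hu.trans (hsq u).symm)
  have hh := QWZeta.analyticAt_hG G hs
  have hl := QWZeta.analyticAt_lG G hs
  have hh0 := QWZeta.hG_half G hhalf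
  have hh' := (QWZeta.hasDerivAt_hG_half G hhalf hs').deriv
  have hderiv : deriv (QWZeta.pG G r) (1 / 2) =
      deriv (QWZeta.hG G s) (1 / 2) * QWZeta.lG G s (1 / 2) := by
    rw [hp.deriv_eq, deriv_mul hh.differentiableAt hl.differentiableAt, hh0, zero_mul, add_zero]
  obtain ⟨k, hk⟩ := Nat.exists_eq_succ_of_ne_zero (Fintype.card_ne_zero (α := V))
  have hk' : Fintype.card V - 1 = k := by omega
  rw [hk', ← hm, ← hn, one_div_pow] at hh'
  have hnk : (n : ℤ) = k + 1 := by omega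
  refine ⟨(hh.mul hl).congr hp.symm, ?_, fun _ => ?_, fun hbip => ?_⟩
  · rw [hp.eq_of_nhds, Pi.mul_apply, hh0, zero_mul]
  · have he : (2 * n - 2 : ℤ) = ((2 * k : ℕ) : ℤ) := by omega
    rw [hderiv, hh', QWZeta.lG_half G hhalf, he, zpow_natCast, hk, pow_mul', pow_succ,
      one_div_pow]
    field_simp
  · have heq := QWZeta.hG_eq_lG_of_isBipartite G hbip s
    refine ⟨by rw [hderiv, ← heq, hh0, mul_zero], ?_⟩
    have hp' : deriv (QWZeta.pG G r) =ᶠ[nhds (1 / 2)]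
        fun u => 2 * (QWZeta.hG G s u * deriv (QWZeta.hG G s) u) := by
      filter_upwards [hp.deriv, hh.eventually_analyticAt] with u hu hua
      rw [hu, ← heq, deriv_mul hua.differentiableAt hua.differentiableAt]
      ring
    -- The exponent is `2 k - 3`, which is negative for small `k`, so it is a difference in `ℤ`.
    have he : (2 * n - 5 : ℤ) = ((2 * k : ℕ) : ℤ) - ((3 : ℕ) : ℤ) := by omega
    have hd := ((hh.differentiableAt.hasDerivAt.fun_mul
      hh.deriv.differentiableAt.hasDerivAt).const_mul 2).deriv
    rw [iteratedDeriv_succ, iteratedDeriv_one, hp'.deriv_eq, hd, hh0, hh', he,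
      zpow_sub₀ two_ne_zero, zpow_natCast, zpow_natCast, pow_mul']
    field_simp
    norm_num
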